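/- Let $k$ be a field, let $d,r\ge 0$ and $n\ge 1$ be integers, and let $g\in A=k[x_1,\dots,x_d]$ be a weighted homogeneous polynomial, i.e. a homogeneous element for some $\mathbb N$-grading on $A$ with $A_0=k$; no condition is imposed relating its degree to $n$. Suppose that $g=h_1\cdots h_r$ with each $h_i\in k[x_1,\dots,x_d]$ irreducible, and that the ring \[ R=k[z,x_0,x_1,\dots,x_d]/(z^n-x_0g) \] is normal (a domain that is integrally closed in its fraction field; with the other hypotheses $R$ is automatically a domain). Let $\operatorname{Cl}(R)$ denote its divisor class group, i.e. the free abelian group on the height one primes of $R$ modulo the divisors of nonzero elements of the fraction field. Then \[ \operatorname{Cl}(R)\cong(\mathbb Z/n\mathbb Z)^r . \] Moreover each ideal $(z,h_i)$ of $R$, $1\le i\le r$, is a prime ideal of height one, the classes of $(z,h_1),\dots,(z,h_r)$ generate $\operatorname{Cl}(R)$, and, if $n\ge 2$, they form a minimal generating set: no proper subfamily generates $\operatorname{Cl}(R)$. -/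

import Mathlib

/-- A polynomial `g` in `A = k[x_1,…,x_d]` is weighted homogeneous if there is an `ℕ`-grading on
the `k`-algebra `A`, with `A_0 = k`, for which `g` is a homogeneous element.
(`1 : Submodule k A` is the image of `k` in `A`.) -/
def IsWeightedHomogeneousPoly {k : Type*} [Field k] {d : ℕ} (g : MvPolynomial (Fin d) k) : Prop :=
  ∃ (𝒜 : ℕ → Submodule k (MvPolynomial (Fin d) k)) (_ : GradedAlgebra 𝒜),
    𝒜 0 = 1 ∧ ∃ m : ℕ, g ∈ 𝒜 m

/-- The prime ideals of height one of a commutative ring. -/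
structure HeightOnePrime (R : Type*) [CommRing R] where
  asIdeal : Ideal R
  isPrime : asIdeal.IsPrime
  height_eq_one : asIdeal.height = 1

/-- The order of `a ∈ R` along a height one prime `p`: the length of `R_p / a R_p`.
When `R_p` is a discrete valuation ring this is the normalized valuation of `a`. -/
noncomputable def HeightOnePrime.ord {R : Type*} [CommRing R] (p : HeightOnePrime R) (a : R) : ℕ∞ :=
  haveI := p.isPrime
  Ring.ord (Localization.AtPrime p.asIdeal) (algebraMap R (Localization.AtPrime p.asIdeal) a)

/-- Weil divisors on `Spec R`: the free abelian group on the height one primes of `R`. -/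
abbrev WeilDivisor (R : Type*) [CommRing R] : Type _ := HeightOnePrime R →₀ ℤ

/-- `D` is the divisor of a fraction `a / b`, with `a` and `b` nonzerodivisors of `R`. -/
def WeilDivisor.IsDivOfFraction {R : Type*} [CommRing R] (D : WeilDivisor R) : Prop :=
  ∃ a ∈ nonZeroDivisors R, ∃ b ∈ nonZeroDivisors R,
    ∀ p : HeightOnePrime R, D p = ((p.ord a).toNat : ℤ) - ((p.ord b).toNat : ℤ)

/-- The group of principal divisors. (For a Noetherian domain the divisors of fractions already
form a subgroup, and every nonzero fraction has a divisor.) -/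
noncomputable def principalDivisors (R : Type*) [CommRing R] : AddSubgroup (WeilDivisor R) :=
  AddSubgroup.closure {D | D.IsDivOfFraction}

/-- The divisor class group `Cl(R)` of a Noetherian normal domain `R`: Weil divisors modulo
principal divisors. -/
abbrev DivisorClassGroup (R : Type*) [CommRing R] : Type _ :=
  WeilDivisor R ⧸ principalDivisors R

/-- The class in `Cl(R)` of a height one prime. -/
noncomputable def HeightOnePrime.divisorClass {R : Type*} [CommRing R] (p : HeightOnePrime R) :
    DivisorClassGroup R :=
  QuotientAddGroup.mk (Finsupp.single p 1)

/-- The ring `k[z,x_0,…,x_d]/(z^n - x_0 g)`, where `g` is a polynomial in `x_1,…,x_d`, as the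
quotient of `k[x_0,…,x_d][z]`. The variable `x_0` is `X 0`, and `x_i` is `X i` for `i ≥ 1`, so that
`g` becomes a polynomial in `x_0,…,x_d` through `Fin.succ`. -/
abbrev CyclicHypersurface {k : Type*} [Field k] {d : ℕ} (n : ℕ) (g : MvPolynomial (Fin d) k) :
    Type _ :=
  AdjoinRoot ((Polynomial.X : Polynomial (MvPolynomial (Fin (d + 1)) k)) ^ n -
    Polynomial.C (MvPolynomial.X 0 * MvPolynomial.rename Fin.succ g))

namespace CyclicHypersurface

/-- The image of the variable `z` in `k[z,x_0,…,x_d]/(z^n - x_0 g)`. -/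
noncomputable def z {k : Type*} [Field k] {d : ℕ} (n : ℕ) (g : MvPolynomial (Fin d) k) :
    CyclicHypersurface n g :=
  AdjoinRoot.root _

/-- The image of a polynomial `h` in `x_1,…,x_d` in `k[z,x_0,…,x_d]/(z^n - x_0 g)`. -/
noncomputable def ofPoly {k : Type*} [Field k] {d : ℕ} (n : ℕ) (g h : MvPolynomial (Fin d) k) :
    CyclicHypersurface n g :=
  AdjoinRoot.of _ (MvPolynomial.rename Fin.succ h)

end CyclicHypersurface

/-!
The argument is Nagata's. Inverting `g` eliminates `x_0 = z^n / g` and turns `R` into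
`k[x_1,…,x_d,z][1/g]`, a localization of a factorial ring, so `Cl(R)` is generated by the height one
primes containing `g`, which are the `(z, h_i)`. The relations come from the units of `R[1/g]`,
which up to units of `R` are products of powers of the `h_i`. For squarefree `g`, the element `z` is
a uniformizer at `(z, h_i)` and `x_0` is a unit there, so `z^n = x_0 g` gives
`div h_i = n · (z, h_i)`. Normality makes `g` squarefree when `n ≥ 2`: if `h² ∣ g`, then
`z^(n-1) / h` is integral over `R`, its `n`-th power being `(x_0 g)^(n-1) / h^n` with
`2 (n - 1) ≥ n`.
-/

theorem height_eq_one_of_mem_minimalPrimes_span_singleton {R : Type*} [CommRing R] [IsDomain R]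
    [IsNoetherianRing R] {I : Ideal R} {a : R} (ha : a ≠ 0)
    (hI : I ∈ (Ideal.span {a}).minimalPrimes) : I.height = 1 :=
  le_antisymm (Ideal.height_le_one_of_isPrincipal_of_mem_minimalPrimes _ I hI)
    ((Ideal.one_le_height_span_singleton_of_mem_nonZeroDivisors
      (mem_nonZeroDivisors_of_ne_zero ha)).trans (Ideal.height_mono hI.1.2))

attribute [ext] HeightOnePrime

namespace HeightOnePrime

variable {R : Type*} [CommRing R]

/-- The order of `a` along `p` as a natural number. The element `0`, whose order is `⊤`, gets the
junk value `0`. -/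
noncomputable def natOrd (p : HeightOnePrime R) (a : R) : ℕ := (p.ord a).toNat

section LocalGenerator

variable (p : HeightOnePrime R) {a : R} (ha : a ∈ p.asIdeal)
  (hgen : ∀ b ∈ p.asIdeal, ∃ s ∉ p.asIdeal, a ∣ s * b)

include ha hgen

theorem span_algebraMap_eq_maximalIdeal :
    haveI := p.isPrime
    Ideal.span {algebraMap R (Localization.AtPrime p.asIdeal) a} =
      IsLocalRing.maximalIdeal (Localization.AtPrime p.asIdeal) := by
  have := p.isPrime
  rw [← Localization.AtPrime.map_eq_maximalIdeal]
  refine le_antisymm ?_ (Ideal.map_le_iff_le_comap.mpr fun b hb => ?_)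
  · rw [Ideal.span_singleton_le_iff_mem]
    exact Ideal.mem_map_of_mem _ ha
  · obtain ⟨s, hs, hdvd⟩ := hgen b hb
    have hunit : IsUnit (algebraMap R (Localization.AtPrime p.asIdeal) s) :=
      (IsLocalization.AtPrime.isUnit_to_map_iff _ p.asIdeal s).mpr hs
    rw [Ideal.mem_comap, Ideal.mem_span_singleton, ← hunit.dvd_mul_left, ← map_mul]
    exact map_dvd _ hdvd

theorem natOrd_eq_one : p.natOrd a = 1 := by
  have := p.isPrime
  have h : p.ord a = 1 := by
    rw [ord, Ring.ord, p.span_algebraMap_eq_maximalIdeal ha hgen, Module.length_eq_one_iff]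
    exact isSimpleModule_iff_isCoatom.mpr (Ideal.isMaximal_def.mp inferInstance)
  rw [natOrd, h, ENat.toNat_one]

end LocalGenerator

theorem natOrd_eq_one_of_asIdeal_eq_span {p : HeightOnePrime R} {a : R}
    (hp : p.asIdeal = Ideal.span {a}) : p.natOrd a = 1 := by
  refine p.natOrd_eq_one (hp ▸ Ideal.mem_span_singleton_self a) fun b hb => ⟨1, ?_, ?_⟩
  · exact p.isPrime.one_notMem
  · rw [one_mul]
    exact Ideal.mem_span_singleton.mp (hp ▸ hb)

theorem ord_of_isUnit (p : HeightOnePrime R) {a : R} (ha : IsUnit a) : p.ord a = 0 :=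
  Ring.ord_of_isUnit (ha.map _)

theorem natOrd_of_isUnit (p : HeightOnePrime R) {a : R} (ha : IsUnit a) : p.natOrd a = 0 := by
  rw [natOrd, p.ord_of_isUnit ha, ENat.toNat_zero]

variable [IsDomain R]

theorem algebraMap_mem_nonZeroDivisors (p : HeightOnePrime R) {a : R} (ha : a ≠ 0) :
    haveI := p.isPrime
    algebraMap R (Localization.AtPrime p.asIdeal) a ∈
      nonZeroDivisors (Localization.AtPrime p.asIdeal) := by
  have := p.isPrime
  have hinj := IsLocalization.injective (Localization.AtPrime p.asIdeal)
    p.asIdeal.primeCompl_le_nonZeroDivisors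
  exact mem_nonZeroDivisors_of_ne_zero ((map_ne_zero_iff _ hinj).mpr ha)

theorem ord_mul (p : HeightOnePrime R) (a : R) {b : R} (hb : b ≠ 0) :
    p.ord (a * b) = p.ord a + p.ord b := by
  rw [ord, map_mul, Ring.ord_mul _ (p.algebraMap_mem_nonZeroDivisors hb)]
  rfl

theorem natOrd_eq_of_associated (p : HeightOnePrime R) {a b : R} (h : Associated a b) :
    p.natOrd a = p.natOrd b := by
  obtain ⟨u, rfl⟩ := h
  rw [natOrd, natOrd, p.ord_mul a u.ne_zero, p.ord_of_isUnit u.isUnit, add_zero]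

theorem asIdeal_ne_bot (p : HeightOnePrime R) : p.asIdeal ≠ ⊥ :=
  Ideal.ne_bot_of_height_eq_one p.height_eq_one

theorem eq_of_le (p : HeightOnePrime R) {I : Ideal R} (hI : I.IsPrime) (hI0 : I ≠ ⊥)
    (hle : I ≤ p.asIdeal) : I = p.asIdeal := by
  have := p.isPrime
  by_contra hne
  have hlt := Ideal.height_add_one_le_of_lt_of_isPrime (lt_of_le_of_ne hle hne)
  rw [p.height_eq_one, ENat.add_one_le_iff (by rintro h; simp [h] at hlt),
    Order.lt_one_iff, Ideal.height_eq_zero_iff_eq_bot] at hlt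
  exact hI0 hlt

theorem mem_minimalPrimes_span_singleton (p : HeightOnePrime R) {a : R} (ha : a ≠ 0)
    (hap : a ∈ p.asIdeal) : p.asIdeal ∈ (Ideal.span {a}).minimalPrimes := by
  refine ⟨⟨p.isPrime, (Ideal.span_singleton_le_iff_mem _).mpr hap⟩, fun I ⟨hI, haI⟩ hle => ?_⟩
  refine (p.eq_of_le hI (fun h => ha ?_) hle).ge
  rwa [h, Ideal.span_singleton_le_iff_mem, Ideal.mem_bot] at haI

variable [IsNoetherianRing R]

theorem ord_ne_top (p : HeightOnePrime R) {a : R} (ha : a ≠ 0) : p.ord a ≠ ⊤ := by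
  have := p.isPrime
  have : Ring.KrullDimLE 1 (Localization.AtPrime p.asIdeal) := by
    rw [Ring.KrullDimLE, Order.krullDimLE_iff]
    have hdim := IsLocalization.AtPrime.ringKrullDim_eq_height p.asIdeal
      (Localization.AtPrime p.asIdeal)
    rw [p.height_eq_one] at hdim
    exact hdim.le
  have : IsNoetherianRing (Localization.AtPrime p.asIdeal) :=
    IsLocalization.isNoetherianRing p.asIdeal.primeCompl _ inferInstance
  exact Ring.ord_ne_top (p.algebraMap_mem_nonZeroDivisors ha)

theorem natOrd_eq_zero_iff (p : HeightOnePrime R) {a : R} (ha : a ≠ 0) :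
    p.natOrd a = 0 ↔ a ∉ p.asIdeal := by
  have := p.isPrime
  rw [natOrd, ENat.toNat_eq_zero, or_iff_left (p.ord_ne_top ha), ord, Ring.ord,
    Module.length_eq_zero_iff, Submodule.Quotient.subsingleton_iff, Ideal.span_singleton_eq_top,
    IsLocalization.AtPrime.isUnit_to_map_iff _ p.asIdeal]
  rfl

theorem natOrd_zero (p : HeightOnePrime R) : p.natOrd 0 = 0 := by
  obtain ⟨a, hap, ha⟩ := Submodule.exists_mem_ne_zero_of_ne_bot p.asIdeal_ne_bot
  refine ENat.toNat_eq_zero.mpr (Or.inr (by_contra fun hfin => ?_))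
  have hord : p.ord 0 + p.ord a = p.ord 0 + 0 := by rw [← p.ord_mul 0 ha, zero_mul, add_zero]
  have ha0 : p.natOrd a = 0 := by
    rw [natOrd, WithTop.add_left_cancel hfin hord, ENat.toNat_zero]
  exact (p.natOrd_eq_zero_iff ha).mp ha0 hap

theorem natOrd_mul (p : HeightOnePrime R) {a b : R} (ha : a ≠ 0) (hb : b ≠ 0) :
    p.natOrd (a * b) = p.natOrd a + p.natOrd b := by
  rw [natOrd, p.ord_mul a hb, ENat.toNat_add (p.ord_ne_top ha) (p.ord_ne_top hb)]
  rfl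

theorem natOrd_pow (p : HeightOnePrime R) {a : R} (ha : a ≠ 0) (n : ℕ) :
    p.natOrd (a ^ n) = n * p.natOrd a := by
  induction n with
  | zero => rw [pow_zero, zero_mul, p.natOrd_of_isUnit isUnit_one]
  | succ n ih => rw [pow_succ, p.natOrd_mul (pow_ne_zero n ha) ha, ih, add_one_mul]

theorem natOrd_eq_of_pow_eq_mul {p : HeightOnePrime R} {z h u : R} {n : ℕ} (hn : n ≠ 0)
    (hp : p.asIdeal = Ideal.span {z, h}) (hz : z ≠ 0) (hu : u ∉ p.asIdeal)
    (hzn : z ^ n = h * u) : p.natOrd h = n := by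
  have hz1 : p.natOrd z = 1 := by
    refine p.natOrd_eq_one (hp ▸ Ideal.subset_span (Or.inl rfl)) fun b hb => ⟨u, hu, ?_⟩
    obtain ⟨c, e, rfl⟩ := Ideal.mem_span_pair.mp (hp ▸ hb)
    have hzh : z ∣ u * h := mul_comm h u ▸ hzn ▸ dvd_pow_self z hn
    rw [mul_add, mul_left_comm, mul_left_comm u]
    exact dvd_add ((dvd_mul_left z u).mul_left c) (hzh.mul_left e)
  have hhu : h * u ≠ 0 := hzn ▸ pow_ne_zero n hz
  have hord := p.natOrd_pow hz n
  rwa [hzn, p.natOrd_mul (left_ne_zero_of_mul hhu) (right_ne_zero_of_mul hhu),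
    (p.natOrd_eq_zero_iff (right_ne_zero_of_mul hhu)).mpr hu, hz1, add_zero, mul_one] at hord

theorem finite_support_natOrd (a : R) :
    (Function.support fun p : HeightOnePrime R => (p.natOrd a : ℤ)).Finite := by
  rcases eq_or_ne a 0 with rfl | ha
  · simp [natOrd_zero]
  · refine Set.Finite.of_finite_image (f := asIdeal)
      (((Ideal.span {a}).finite_minimalPrimes_of_isNoetherianRing R).subset ?_)
      fun p _ q _ h => HeightOnePrime.ext h
    rintro _ ⟨p, hp, rfl⟩
    refine p.mem_minimalPrimes_span_singleton ha (by_contra fun hap => hp ?_)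
    exact Nat.cast_eq_zero.mpr ((p.natOrd_eq_zero_iff ha).mpr hap)

end HeightOnePrime

namespace WeilDivisor

variable {R : Type*} [CommRing R]

theorem mk_single (p : HeightOnePrime R) (m : ℤ) :
    (QuotientAddGroup.mk (Finsupp.single p m) : DivisorClassGroup R) = m • p.divisorClass := by
  rw [HeightOnePrime.divisorClass, ← QuotientAddGroup.mk_zsmul, Finsupp.smul_single_one]

theorem mk_mem_of_divisorClass_mem {H : AddSubgroup (DivisorClassGroup R)} {D : WeilDivisor R}
    (h : ∀ q, D q ≠ 0 → q.divisorClass ∈ H) :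
    (QuotientAddGroup.mk D : DivisorClassGroup R) ∈ H := by
  rw [← Finsupp.sum_single D, Finsupp.sum, QuotientAddGroup.mk_sum]
  refine AddSubgroup.sum_mem _ fun q hq => ?_
  rw [mk_single]
  exact AddSubgroup.zsmul_mem _ (h q (Finsupp.mem_support_iff.mp hq)) _

variable [IsDomain R] [IsNoetherianRing R]

/-- The principal divisor of `a`, with the junk value `div 0 = 0`. -/
noncomputable def div (a : R) : WeilDivisor R :=
  Finsupp.ofSupportFinite _ (HeightOnePrime.finite_support_natOrd a)

@[simp]
theorem div_apply (a : R) (p : HeightOnePrime R) : div a p = p.natOrd a := rfl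

theorem div_one : div (1 : R) = 0 := by
  ext p
  simp [p.natOrd_of_isUnit isUnit_one]

theorem div_mul {a b : R} (ha : a ≠ 0) (hb : b ≠ 0) : div (a * b) = div a + div b := by
  ext p
  simp [p.natOrd_mul ha hb]

theorem isDivOfFraction_iff {D : WeilDivisor R} :
    D.IsDivOfFraction ↔ ∃ a b : R, a ≠ 0 ∧ b ≠ 0 ∧ D = div a - div b := by
  simp only [IsDivOfFraction, mem_nonZeroDivisors_iff_ne_zero, Finsupp.ext_iff]
  exact ⟨fun ⟨a, ha, b, hb, h⟩ => ⟨a, b, ha, hb, h⟩, fun ⟨a, b, ha, hb, h⟩ => ⟨a, ha, b, hb, h⟩⟩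

theorem mem_principalDivisors_iff {D : WeilDivisor R} :
    D ∈ principalDivisors R ↔ ∃ a b : R, a ≠ 0 ∧ b ≠ 0 ∧ D = div a - div b := by
  refine ⟨fun hD => ?_, fun h => AddSubgroup.subset_closure (isDivOfFraction_iff.mpr h)⟩
  induction hD using AddSubgroup.closure_induction with
  | mem D hD => exact isDivOfFraction_iff.mp hD
  | zero => exact ⟨1, 1, one_ne_zero, one_ne_zero, (sub_self _).symm⟩
  | add D E _ _ hD hE =>
    obtain ⟨a, b, ha, hb, rfl⟩ := hD
    obtain ⟨a', b', ha', hb', rfl⟩ := hE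
    refine ⟨a * a', b * b', mul_ne_zero ha ha', mul_ne_zero hb hb', ?_⟩
    rw [div_mul ha ha', div_mul hb hb', add_sub_add_comm]
  | neg D _ hD =>
    obtain ⟨a, b, ha, hb, rfl⟩ := hD
    exact ⟨b, a, hb, ha, neg_sub _ _⟩

theorem mk_div {a : R} (ha : a ≠ 0) : (QuotientAddGroup.mk (div a) : DivisorClassGroup R) = 0 :=
  (QuotientAddGroup.eq_zero_iff _).mpr
    (mem_principalDivisors_iff.mpr ⟨a, 1, ha, one_ne_zero, by rw [div_one, sub_zero]⟩)

section DivEqSingle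

variable {p : HeightOnePrime R} {a : R} {n : ℕ} (ha : a ≠ 0)
  (hdiv : div a = Finsupp.single p (n : ℤ))

include ha hdiv

theorem nsmul_divisorClass_eq_zero : n • p.divisorClass = 0 := by
  rw [← natCast_zsmul, ← mk_single, ← hdiv, mk_div ha]

theorem eq_of_mem_of_div_eq_single {q : HeightOnePrime R} (haq : a ∈ q.asIdeal) : q = p := by
  by_contra hne
  refine (q.natOrd_eq_zero_iff ha).mp ((Nat.cast_inj (R := ℤ)).mp ?_) haq
  rw [← div_apply, hdiv, Finsupp.single_eq_of_ne hne, Nat.cast_zero]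

theorem mem_of_div_eq_single (hn : n ≠ 0) : a ∈ p.asIdeal := by
  by_contra hap
  have hap0 := (p.natOrd_eq_zero_iff ha).mpr hap
  rw [← Nat.cast_inj (R := ℤ), ← div_apply, hdiv, Finsupp.single_eq_same, Nat.cast_inj] at hap0
  exact hn hap0

end DivEqSingle

end WeilDivisor

/-- The contraction to `R` of the ideal of `R[1/y]` generated by `f`. -/
def spanAway {R : Type*} [CommRing R] (y f : R) : Ideal R where
  carrier := {a | ∃ N : ℕ, f ∣ y ^ N * a}
  zero_mem' := ⟨0, by rw [mul_zero]; exact dvd_zero f⟩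
  add_mem' := by
    rintro a b ⟨N, hN⟩ ⟨M, hM⟩
    refine ⟨N + M, ?_⟩
    rw [mul_add, pow_add, mul_right_comm, mul_assoc (y ^ N) (y ^ M) b]
    exact dvd_add (hN.mul_right _) (hM.mul_left _)
  smul_mem' := by
    rintro c a ⟨N, hN⟩
    exact ⟨N, by rw [smul_eq_mul, mul_left_comm]; exact hN.mul_left c⟩

namespace spanAway

variable {R : Type*} [CommRing R] {y f : R}

theorem mem_iff {a : R} : a ∈ spanAway y f ↔ ∃ N : ℕ, f ∣ y ^ N * a := Iff.rfl

theorem self_mem : f ∈ spanAway y f := ⟨0, dvd_mul_left f _⟩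

theorem pow_mul_mem_iff {a : R} (N : ℕ) : y ^ N * a ∈ spanAway y f ↔ a ∈ spanAway y f := by
  refine ⟨fun ⟨M, hM⟩ => ⟨M + N, ?_⟩, fun h => Ideal.mul_mem_left _ _ h⟩
  rwa [pow_add, mul_assoc]

theorem le_of_isPrime {q : Ideal R} (hq : q.IsPrime) (hf : f ∈ q) (hy : y ∉ q) :
    spanAway y f ≤ q := by
  rintro a ⟨N, hN⟩
  exact (hq.mem_or_mem (q.mem_of_dvd hN hf)).resolve_left fun h => hy (hq.mem_of_pow_mem N h)

end spanAway

/-- An injective ring homomorphism `j : B → R` that becomes an isomorphism after inverting `g`. -/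
structure IsIsoAway {B R : Type*} [CommRing B] [CommRing R] (j : B →+* R) (g : B) : Prop where
  injective : Function.Injective j
  exists_pow_mul_eq : ∀ a : R, ∃ (N : ℕ) (b : B), j g ^ N * a = j b

namespace IsIsoAway

open WeilDivisor

variable {B R : Type*} [CommRing B] [CommRing R] {j : B →+* R} {g : B} (hj : IsIsoAway j g)

theorem of_closure_eq_top {x : R} (hinj : Function.Injective j)
    (hgen : Subring.closure (insert x (Set.range j)) = ⊤)
    (hx : ∃ (N : ℕ) (b : B), j g ^ N * x = j b) : IsIsoAway j g := by
  refine ⟨hinj, fun a => ?_⟩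
  have ha : a ∈ Subring.closure (insert x (Set.range j)) := hgen ▸ Subring.mem_top a
  induction ha using Subring.closure_induction with
  | mem a ha =>
    rcases ha with rfl | ⟨b, rfl⟩
    · exact hx
    · exact ⟨0, b, by rw [pow_zero, one_mul]⟩
  | zero => exact ⟨0, 0, by rw [mul_zero, map_zero]⟩
  | one => exact ⟨0, 1, by rw [pow_zero, one_mul, map_one]⟩
  | add a a' _ _ ha ha' =>
    obtain ⟨N, b, hb⟩ := ha
    obtain ⟨N', b', hb'⟩ := ha'
    refine ⟨N + N', g ^ N' * b + g ^ N * b', ?_⟩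
    simp only [map_add, map_mul, map_pow]
    linear_combination j g ^ N' * hb + j g ^ N * hb'
  | neg a _ ha =>
    obtain ⟨N, b, hb⟩ := ha
    exact ⟨N, -b, by rw [mul_neg, hb, map_neg]⟩
  | mul a a' _ _ ha ha' =>
    obtain ⟨N, b, hb⟩ := ha
    obtain ⟨N', b', hb'⟩ := ha'
    exact ⟨N + N', b * b', by rw [pow_add, mul_mul_mul_comm, hb, hb', map_mul]⟩

include hj

theorem map_ne_zero {b : B} (hb : b ≠ 0) : j b ≠ 0 := (map_ne_zero_iff j hj.injective).mpr hb

section PrimeAway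

variable {f : B} (hf : Prime f) (hfg : ¬ f ∣ g)

include hf hfg

theorem map_mem_spanAway_iff {b : B} : j b ∈ spanAway (j g) (j f) ↔ f ∣ b := by
  refine ⟨fun ⟨N, c, hc⟩ => ?_, fun h => Ideal.mem_of_dvd _ (map_dvd j h) spanAway.self_mem⟩
  obtain ⟨M, e, he⟩ := hj.exists_pow_mul_eq c
  have hdvd : f ∣ g ^ (M + N) * b := by
    refine ⟨e, hj.injective ?_⟩
    rw [map_mul, map_mul, map_pow, pow_add, mul_assoc, hc, mul_left_comm, he]
  exact (hf.dvd_or_dvd hdvd).resolve_left fun h => hfg (hf.dvd_of_dvd_pow h)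

theorem isPrime_spanAway : (spanAway (j g) (j f)).IsPrime := by
  refine ⟨?_, fun {a a'} h => ?_⟩
  · rw [Ne, Ideal.eq_top_iff_one, ← map_one j, hj.map_mem_spanAway_iff hf hfg]
    exact hf.not_dvd_one
  · obtain ⟨N, b, hb⟩ := hj.exists_pow_mul_eq a
    obtain ⟨N', b', hb'⟩ := hj.exists_pow_mul_eq a'
    rw [← spanAway.pow_mul_mem_iff (N + N'), pow_add, mul_mul_mul_comm, hb, hb', ← map_mul,
      hj.map_mem_spanAway_iff hf hfg] at h
    rw [← spanAway.pow_mul_mem_iff N, ← spanAway.pow_mul_mem_iff (a := a') N', hb, hb',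
      hj.map_mem_spanAway_iff hf hfg, hj.map_mem_spanAway_iff hf hfg]
    exact hf.dvd_or_dvd h

variable [IsDomain R] [IsNoetherianRing R]

theorem height_spanAway : (spanAway (j g) (j f)).height = 1 := by
  have hprime := hj.isPrime_spanAway hf hfg
  refine height_eq_one_of_mem_minimalPrimes_span_singleton (hj.map_ne_zero hf.ne_zero)
    ⟨⟨hprime, (Ideal.span_singleton_le_iff_mem _).mpr spanAway.self_mem⟩, fun I ⟨hI, hfI⟩ hle => ?_⟩
  refine spanAway.le_of_isPrime hI ((Ideal.span_singleton_le_iff_mem _).mp hfI) fun hgI => hfg ?_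
  exact (hj.map_mem_spanAway_iff hf hfg).mp (hle hgI)

omit hj in
/-- The height one prime of `R` whose extension to `R[1/g] = B[1/g]` is generated by the prime
element `f` of `B`. -/
noncomputable def primeAway (hj : IsIsoAway j g) : HeightOnePrime R :=
  ⟨spanAway (j g) (j f), hj.isPrime_spanAway hf hfg, hj.height_spanAway hf hfg⟩

theorem map_notMem_primeAway : j g ∉ (hj.primeAway hf hfg).asIdeal :=
  fun h => hfg ((hj.map_mem_spanAway_iff hf hfg).mp h)

theorem eq_primeAway {q : HeightOnePrime R} (hfq : j f ∈ q.asIdeal) (hgq : j g ∉ q.asIdeal) :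
    q = hj.primeAway hf hfg :=
  HeightOnePrime.ext (q.eq_of_le (hj.primeAway hf hfg).isPrime
    (hj.primeAway hf hfg).asIdeal_ne_bot (spanAway.le_of_isPrime q.isPrime hfq hgq)).symm

theorem natOrd_primeAway : (hj.primeAway hf hfg).natOrd (j f) = 1 := by
  refine HeightOnePrime.natOrd_eq_one _ spanAway.self_mem fun b ⟨N, hN⟩ => ⟨j g ^ N, ?_, hN⟩
  exact fun h => hj.map_notMem_primeAway hf hfg ((hj.primeAway hf hfg).isPrime.mem_of_pow_mem N h)

end PrimeAway

variable [IsDomain R] [IsNoetherianRing R] [UniqueFactorizationMonoid B]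

theorem exists_eq_primeAway {q : HeightOnePrime R} (hgq : j g ∉ q.asIdeal) :
    ∃ (f : B) (hf : Prime f) (hfg : ¬ f ∣ g), q = hj.primeAway hf hfg := by
  have hq := q.isPrime
  obtain ⟨a, haq, ha⟩ := Submodule.exists_mem_ne_zero_of_ne_bot q.asIdeal_ne_bot
  obtain ⟨N, b, hb⟩ := hj.exists_pow_mul_eq a
  have hg : j g ≠ 0 := fun h => hgq (h ▸ zero_mem q.asIdeal)
  have hcomap : Ideal.comap j q.asIdeal ≠ ⊥ := by
    refine (Submodule.ne_bot_iff _).mpr ⟨b, ?_, ?_⟩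
    · rw [Ideal.mem_comap, ← hb]
      exact Ideal.mul_mem_left _ _ haq
    · rintro rfl
      rw [map_zero] at hb
      exact mul_ne_zero (pow_ne_zero N hg) ha hb
  obtain ⟨f, hfq, hf⟩ := Ideal.IsPrime.exists_mem_prime_of_ne_bot
    (Ideal.comap_isPrime j q.asIdeal) hcomap
  have hfg : ¬ f ∣ g := fun h => hgq (Ideal.mem_of_dvd _ (map_dvd j h) hfq)
  exact ⟨f, hf, hfg, hj.eq_primeAway hf hfg hfq hgq⟩

theorem closure_divisorClass_eq_top :
    AddSubgroup.closure (HeightOnePrime.divisorClass '' {p : HeightOnePrime R | j g ∈ p.asIdeal}) =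
      ⊤ := by
  set H := AddSubgroup.closure
    (HeightOnePrime.divisorClass '' {p : HeightOnePrime R | j g ∈ p.asIdeal})
  have hover : ∀ p : HeightOnePrime R, j g ∈ p.asIdeal → p.divisorClass ∈ H := fun p hp =>
    AddSubgroup.subset_closure ⟨p, hp, rfl⟩
  suffices hall : ∀ q : HeightOnePrime R, q.divisorClass ∈ H by
    refine (AddSubgroup.eq_top_iff' H).mpr fun x => ?_
    obtain ⟨D, rfl⟩ := QuotientAddGroup.mk_surjective x
    exact mk_mem_of_divisorClass_mem fun q _ => hall q
  intro q
  by_cases hgq : j g ∈ q.asIdeal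
  · exact hover q hgq
  obtain ⟨f, hf, hfg, rfl⟩ := hj.exists_eq_primeAway hgq
  set q := hj.primeAway hf hfg
  have hclass : q.divisorClass = QuotientAddGroup.mk (Finsupp.single q 1 - div (j f)) := by
    rw [QuotientAddGroup.mk_sub, mk_div (hj.map_ne_zero hf.ne_zero), sub_zero]
    rfl
  rw [hclass]
  refine mk_mem_of_divisorClass_mem fun q' hq' => hover q' (by_contra fun hgq' => hq' ?_)
  rw [Finsupp.sub_apply, div_apply]
  by_cases hfq' : j f ∈ q'.asIdeal
  · rw [hj.eq_primeAway hf hfg hfq' hgq', Finsupp.single_eq_same, hj.natOrd_primeAway,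
      Nat.cast_one, sub_self]
  · have hne : q' ≠ q := fun h => hfq' (h ▸ spanAway.self_mem)
    rw [Finsupp.single_eq_of_ne hne, (q'.natOrd_eq_zero_iff (hj.map_ne_zero hf.ne_zero)).mpr hfq',
      Nat.cast_zero, sub_zero]

theorem map_dvd_pow_mul_of_natOrd_le (α : B) (hα : α ≠ 0) {b : R} (hb : b ≠ 0)
    (hle : ∀ q : HeightOnePrime R, j g ∉ q.asIdeal → q.natOrd (j α) ≤ q.natOrd b) :
    ∃ N : ℕ, j α ∣ j g ^ N * b := by
  induction α using UniqueFactorizationMonoid.induction_on_prime generalizing b with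
  | h₁ => exact absurd rfl hα
  | h₂ α hunit => exact ⟨0, (hunit.map j).dvd⟩
  | h₃ α f hα₀ hf ih =>
    have hjα := hj.map_ne_zero hα₀
    have hjf := hj.map_ne_zero hf.ne_zero
    have hord : ∀ q : HeightOnePrime R, q.natOrd (j (f * α)) = q.natOrd (j f) + q.natOrd (j α) :=
      fun q => by rw [map_mul, q.natOrd_mul hjf hjα]
    by_cases hfg : f ∣ g
    · obtain ⟨N, hN⟩ := ih hα₀ hb fun q hq => (hord q ▸ Nat.le_add_left _ _).trans (hle q hq)
      refine ⟨N + 1, ?_⟩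
      rw [map_mul, pow_succ', mul_assoc]
      exact mul_dvd_mul (map_dvd j hfg) hN
    · have hbq : b ∈ (hj.primeAway hf hfg).asIdeal := by
        have hle' := hle _ (hj.map_notMem_primeAway hf hfg)
        rw [hord, hj.natOrd_primeAway] at hle'
        by_contra hmem
        rw [((hj.primeAway hf hfg).natOrd_eq_zero_iff hb).mpr hmem] at hle'
        lia
      obtain ⟨M, c, hc⟩ := spanAway.mem_iff.mp hbq
      have hgM : j g ^ M ≠ 0 := pow_ne_zero M fun h => hj.map_notMem_primeAway hf hfg
        (h ▸ zero_mem _)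
      have hc0 : c ≠ 0 := right_ne_zero_of_mul (hc ▸ mul_ne_zero hgM hb)
      obtain ⟨N, hN⟩ := ih hα₀ hc0 fun q hq => by
        have hgq : q.natOrd (j g ^ M) = 0 :=
          (q.natOrd_eq_zero_iff hgM).mpr fun h => hq (q.isPrime.mem_of_pow_mem M h)
        have hordc : q.natOrd b = q.natOrd (j f) + q.natOrd c := by
          rw [← q.natOrd_mul hjf hc0, ← hc, q.natOrd_mul hgM hb, hgq, zero_add]
        exact Nat.le_of_add_le_add_left (hordc ▸ hord q ▸ hle q hq)
      refine ⟨N + M, ?_⟩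
      rw [map_mul, pow_add, mul_assoc, hc, mul_left_comm]
      exact mul_dvd_mul_left _ hN

theorem dvd_pow_mul_of_natOrd_le (hg : g ≠ 0) {a b : R} (ha : a ≠ 0) (hb : b ≠ 0)
    (hle : ∀ q : HeightOnePrime R, j g ∉ q.asIdeal → q.natOrd a ≤ q.natOrd b) :
    ∃ N : ℕ, a ∣ j g ^ N * b := by
  obtain ⟨M, α, hα⟩ := hj.exists_pow_mul_eq a
  have hgM : j g ^ M ≠ 0 := pow_ne_zero M (hj.map_ne_zero hg)
  have hα0 : α ≠ 0 := fun h => mul_ne_zero hgM ha (by rw [hα, h, map_zero])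
  obtain ⟨N, hN⟩ := hj.map_dvd_pow_mul_of_natOrd_le α hα0 hb fun q hq => by
    rw [← hα, q.natOrd_mul hgM ha, (q.natOrd_eq_zero_iff hgM).mpr fun h =>
      hq (q.isPrime.mem_of_pow_mem M h), zero_add]
    exact hle q hq
  exact ⟨N, (hα ▸ dvd_mul_left a _ : a ∣ j α).trans hN⟩

section DvdNatOrd

variable {p : HeightOnePrime R} {n : ℕ} (hp : ∀ f : B, Prime f → f ∣ g → n ∣ p.natOrd (j f))

include hp

theorem dvd_natOrd_map_of_dvd_pow {γ : B} (hγ : γ ≠ 0) {N : ℕ} (hdvd : γ ∣ g ^ N) :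
    n ∣ p.natOrd (j γ) := by
  induction γ using UniqueFactorizationMonoid.induction_on_prime with
  | h₁ => exact absurd rfl hγ
  | h₂ γ hunit => simp [p.natOrd_of_isUnit (hunit.map j)]
  | h₃ γ f hγ₀ hf ih =>
    rw [map_mul, p.natOrd_mul (hj.map_ne_zero hf.ne_zero) (hj.map_ne_zero hγ₀)]
    exact dvd_add (hp f hf (hf.dvd_of_dvd_pow (dvd_of_mul_right_dvd hdvd)))
      (ih hγ₀ (dvd_of_mul_left_dvd hdvd))

theorem dvd_natOrd_of_dvd_pow (hg : g ≠ 0) {c : R} {N : ℕ} (hdvd : c ∣ j g ^ N) :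
    n ∣ p.natOrd c := by
  have hjg := hj.map_ne_zero hg
  obtain ⟨e, he⟩ := hdvd
  have hc : c ≠ 0 := left_ne_zero_of_mul (he ▸ pow_ne_zero N hjg)
  obtain ⟨M, γ, hγ⟩ := hj.exists_pow_mul_eq c
  obtain ⟨K, ε, hε⟩ := hj.exists_pow_mul_eq e
  have hγg : γ ∣ g ^ (M + K + N) := by
    refine ⟨ε, hj.injective ?_⟩
    rw [map_mul, ← hγ, ← hε, mul_mul_mul_comm, ← he, map_pow, pow_add, pow_add]
  have hγ0 : γ ≠ 0 := fun h => mul_ne_zero (pow_ne_zero M hjg) hc (by rw [hγ, h, map_zero])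
  have hord := hj.dvd_natOrd_map_of_dvd_pow hp hγ0 hγg
  rw [← hγ, p.natOrd_mul (pow_ne_zero M hjg) hc] at hord
  refine (Nat.dvd_add_right ?_).mp hord
  rw [← map_pow]
  exact hj.dvd_natOrd_map_of_dvd_pow hp (pow_ne_zero M hg) dvd_rfl

theorem dvd_apply_of_mem_principalDivisors (hg : g ≠ 0) {D : WeilDivisor R}
    (hD : D ∈ principalDivisors R) (haway : ∀ q : HeightOnePrime R, j g ∉ q.asIdeal → D q = 0) :
    (n : ℤ) ∣ D p := by
  obtain ⟨a, b, ha, hb, rfl⟩ := mem_principalDivisors_iff.mp hD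
  have heq : ∀ q : HeightOnePrime R, j g ∉ q.asIdeal → q.natOrd a = q.natOrd b := fun q hq =>
    Nat.cast_injective (sub_eq_zero.mp (haway q hq))
  obtain ⟨N, c, hc⟩ := hj.dvd_pow_mul_of_natOrd_le hg ha hb fun q hq => (heq q hq).le
  obtain ⟨M, e, he⟩ := hj.dvd_pow_mul_of_natOrd_le hg hb ha fun q hq => (heq q hq).ge
  have hgN : j g ^ N ≠ 0 := pow_ne_zero N (hj.map_ne_zero hg)
  have hc0 : c ≠ 0 := right_ne_zero_of_mul (hc ▸ mul_ne_zero hgN hb)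
  have hce : j g ^ (N + M) = c * e := by
    refine mul_right_cancel₀ (mul_ne_zero ha hb) ?_
    linear_combination j g ^ M * a * hc + a * c * he
  have hcdvd : n ∣ p.natOrd c := hj.dvd_natOrd_of_dvd_pow hp hg ⟨e, hce⟩
  have hgdvd : n ∣ p.natOrd (j g ^ N) := hj.dvd_natOrd_of_dvd_pow hp hg dvd_rfl
  have hord : p.natOrd (j g ^ N) + p.natOrd b = p.natOrd a + p.natOrd c := by
    rw [← p.natOrd_mul hgN hb, hc, p.natOrd_mul ha hc0]
  have hdiff : (div a - div b) p = (p.natOrd (j g ^ N) : ℤ) - p.natOrd c := by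
    rw [Finsupp.sub_apply, div_apply, div_apply]
    lia
  rw [hdiff]
  exact dvd_sub (Int.natCast_dvd_natCast.mpr hgdvd) (Int.natCast_dvd_natCast.mpr hcdvd)

end DvdNatOrd

end IsIsoAway

namespace IsIsoAway

open WeilDivisor

variable {ι B R : Type*} [Fintype ι] [CommRing B] [UniqueFactorizationMonoid B] [CommRing R]
  [IsDomain R] [IsNoetherianRing R] {j : B →+* R} {f : ι → B} {p : ι → HeightOnePrime R} {n : ι → ℕ}
  (hj : IsIsoAway j (∏ i, f i)) (hdiv : ∀ i, div (j (f i)) = Finsupp.single (p i) (n i : ℤ))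

include hj hdiv

theorem closure_range_divisorClass_eq_top (hf : ∀ i, f i ≠ 0) :
    AddSubgroup.closure (Set.range fun i => (p i).divisorClass) = ⊤ := by
  rw [eq_top_iff, ← hj.closure_divisorClass_eq_top, AddSubgroup.closure_le]
  rintro _ ⟨q, hq, rfl⟩
  have := q.isPrime
  obtain ⟨i, -, hi⟩ := Ideal.IsPrime.prod_mem_iff.mp (map_prod j f _ ▸ hq)
  rw [eq_of_mem_of_div_eq_single (hj.map_ne_zero (hf i)) (hdiv i) hi]
  exact AddSubgroup.subset_closure ⟨i, rfl⟩

omit hj in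
theorem dvd_natOrd_map_of_dvd_prod (hf : ∀ i, Prime (f i)) (hp : Function.Injective p) (i : ι)
    {f' : B} (hf' : Prime f') (hdvd : f' ∣ ∏ l, f l) : n i ∣ (p i).natOrd (j f') := by
  obtain ⟨l, -, hl⟩ := (hf'.dvd_finsetProd_iff f).mp hdvd
  rw [(p i).natOrd_eq_of_associated ((hf'.associated_of_dvd (hf l) hl).map j),
    ← Int.natCast_dvd_natCast, ← div_apply, hdiv]
  rcases eq_or_ne i l with rfl | hil
  · rw [Finsupp.single_eq_same]
  · rw [Finsupp.single_eq_of_ne (hp.ne hil)]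
    exact dvd_zero _

theorem sum_zsmul_divisorClass_eq_zero_iff (hf : ∀ i, Prime (f i)) (hn : ∀ i, n i ≠ 0)
    (hp : Function.Injective p) {m : ι → ℤ} :
    ∑ i, m i • (p i).divisorClass = 0 ↔ ∀ i, (n i : ℤ) ∣ m i := by
  classical
  have hf0 : ∀ i, j (f i) ≠ 0 := fun i => hj.map_ne_zero (hf i).ne_zero
  refine ⟨fun h i => ?_, fun h => Finset.sum_eq_zero fun i _ => ?_⟩
  · set D : WeilDivisor R := ∑ l, Finsupp.single (p l) (m l) with hD
    have hD_apply : ∀ q, D q = ∑ l, if p l = q then m l else 0 := fun q => by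
      simp only [hD, Finsupp.finsetSum_apply, Finsupp.single_apply]
    have hD_mem : D ∈ principalDivisors R := by
      rw [← QuotientAddGroup.eq_zero_iff, ← h, hD, QuotientAddGroup.mk_sum]
      exact Finset.sum_congr rfl fun l _ => mk_single (p l) (m l)
    have hDi : D (p i) = m i := by
      rw [hD_apply, Finset.sum_eq_single i (fun l _ hl => if_neg (hp.ne hl)) (by simp), if_pos rfl]
    have haway : ∀ q : HeightOnePrime R, j (∏ l, f l) ∉ q.asIdeal → D q = 0 := fun q hq => by
      rw [hD_apply]
      refine Finset.sum_eq_zero fun l _ => if_neg ?_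
      rintro rfl
      exact hq (Ideal.mem_of_dvd _ (map_dvd j (Finset.dvd_prod_of_mem f (Finset.mem_univ l)))
        (mem_of_div_eq_single (hf0 l) (hdiv l) (hn l)))
    have := j.domain_nontrivial
    rw [← hDi]
    exact hj.dvd_apply_of_mem_principalDivisors
      (fun _ hf' hdvd => dvd_natOrd_map_of_dvd_prod hdiv hf hp i hf' hdvd)
      (Finset.prod_ne_zero_iff.mpr fun l _ => (hf l).ne_zero) hD_mem haway
  · obtain ⟨c, hc⟩ := h i
    rw [hc, mul_comm, mul_zsmul, natCast_zsmul, nsmul_divisorClass_eq_zero (hf0 i) (hdiv i),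
      zsmul_zero]

end IsIsoAway

section CyclicFactors

variable {ι G : Type*} [DecidableEq ι] [AddCommGroup G] {x : ι → G} {n : ι → ℕ}

theorem exists_addEquiv_pi_zmod [Fintype ι] (hgen : AddSubgroup.closure (Set.range x) = ⊤)
    (hrel : ∀ m : ι → ℤ, ∑ i, m i • x i = 0 ↔ ∀ i, (n i : ℤ) ∣ m i) :
    ∃ e : G ≃+ (∀ i, ZMod (n i)), ∀ i, e (x i) = Pi.single i 1 := by
  let φ : (ι → ℤ) →+ G := (Fintype.linearCombination ℤ x).toAddMonoidHom
  let ψ : (ι → ℤ) →+ ∀ i, ZMod (n i) := AddMonoidHom.piMap fun i => Int.castAddHom (ZMod (n i))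
  have hφ : Function.Surjective φ := by
    rw [← AddMonoidHom.range_eq_top, ← top_le_iff, ← hgen, AddSubgroup.closure_le]
    rintro _ ⟨i, rfl⟩
    exact ⟨Pi.single i 1, by simp [φ]⟩
  have hψ : Function.Surjective ψ := fun y =>
    ⟨fun i => (ZMod.intCast_surjective (y i)).choose,
      funext fun i => (ZMod.intCast_surjective (y i)).choose_spec⟩
  have hker : φ.ker = ψ.ker := by
    ext m
    simp only [AddMonoidHom.mem_ker, funext_iff]
    exact (hrel m).trans (forall_congr' fun i => (ZMod.intCast_zmod_eq_zero_iff_dvd _ _).symm)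
  have hlift : ∀ m, φ.liftOfSurjective hφ ⟨ψ, hker.le⟩ (φ m) = ψ m :=
    φ.liftOfRightInverse_comp_apply _ _ ⟨ψ, hker.le⟩
  refine ⟨AddEquiv.ofBijective (φ.liftOfSurjective hφ ⟨ψ, hker.le⟩)
    ⟨(injective_iff_map_eq_zero _).mpr fun y hy => ?_, fun y => ?_⟩, fun i => ?_⟩
  · obtain ⟨m, rfl⟩ := hφ y
    rw [hlift] at hy
    exact hker.ge hy
  · obtain ⟨m, rfl⟩ := hψ y
    exact ⟨φ m, hlift m⟩
  · have hx : x i = φ (Pi.single i 1) := by simp [φ]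
    rw [hx]
    refine (hlift _).trans ?_
    ext l
    exact (Pi.apply_single (fun l => Int.castAddHom (ZMod (n l))) (fun _ => map_zero _) i 1 l).trans
      (by simp only [Int.coe_castAddHom, Int.cast_one])

theorem eq_univ_of_closure_image_eq_top (e : G ≃+ (∀ i, ZMod (n i)))
    (he : ∀ i, e (x i) = Pi.single i 1) (hn : ∀ i, n i ≠ 1) {s : Set ι}
    (hs : AddSubgroup.closure (x '' s) = ⊤) : s = Set.univ := by
  refine Set.eq_univ_of_forall fun i => by_contra fun hi => ?_
  let π : G →+ ZMod (n i) := (Pi.evalAddMonoidHom (fun i => ZMod (n i)) i).comp e.toAddMonoidHom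
  have hπ : ∀ l, π (x l) = (Pi.single l 1 : ∀ l, ZMod (n l)) i := fun l => congrFun (he l) i
  have hle : AddSubgroup.closure (x '' s) ≤ π.ker := by
    rw [AddSubgroup.closure_le]
    rintro _ ⟨l, hl, rfl⟩
    exact (hπ l).trans (Pi.single_eq_of_ne (by rintro rfl; exact hi hl) 1)
  have hone : (1 : ZMod (n i)) = 0 := by
    rw [← (hπ i).trans (Pi.single_eq_same i _)]
    exact hle (hs ▸ AddSubgroup.mem_top (x i))
  have : Nontrivial (ZMod (n i)) := ZMod.nontrivial_iff.mpr (hn i)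
  exact one_ne_zero hone

end CyclicFactors

section AdjoinRootQuotient

variable {A : Type*} [CommRing A] {f : Polynomial A} {a : A} (ha : a ∣ f.coeff 0)

/-- The quotient map `A[X]/(f) → A/(a)` that kills `X`, where `a` divides the constant term
of `f`. -/
noncomputable def adjoinRootToQuotient : AdjoinRoot f →+* A ⧸ Ideal.span {a} :=
  AdjoinRoot.lift (Ideal.Quotient.mk _) 0 <| by
    rw [Polynomial.eval₂_at_zero, Ideal.Quotient.eq_zero_iff_dvd]
    exact ha

theorem adjoinRootToQuotient_of (b : A) :
    adjoinRootToQuotient ha (AdjoinRoot.of f b) = Ideal.Quotient.mk _ b :=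
  AdjoinRoot.lift_of _

theorem ker_adjoinRootToQuotient :
    RingHom.ker (adjoinRootToQuotient ha) = Ideal.span {AdjoinRoot.root f, AdjoinRoot.of f a} := by
  refine le_antisymm (fun x hx => ?_) ?_
  · obtain ⟨p, rfl⟩ := AdjoinRoot.mk_surjective x
    rw [RingHom.mem_ker, adjoinRootToQuotient, AdjoinRoot.lift_mk, Polynomial.eval₂_at_zero,
      Ideal.Quotient.eq_zero_iff_dvd] at hx
    obtain ⟨c, hc⟩ := hx
    rw [← Polynomial.divX_mul_X_add p, hc, Ideal.mem_span_pair]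
    refine ⟨AdjoinRoot.mk f p.divX, AdjoinRoot.of f c, ?_⟩
    simp only [map_add, map_mul, AdjoinRoot.mk_X, AdjoinRoot.mk_C, mul_comm]
  · rw [Ideal.span_le, Set.insert_subset_iff, Set.singleton_subset_iff]
    refine ⟨AdjoinRoot.lift_root _, ?_⟩
    rw [SetLike.mem_coe, RingHom.mem_ker, adjoinRootToQuotient_of, Ideal.Quotient.eq_zero_iff_dvd]

include ha

theorem of_mem_span_root_of_iff {b : A} :
    AdjoinRoot.of f b ∈ Ideal.span {AdjoinRoot.root f, AdjoinRoot.of f a} ↔ a ∣ b := by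
  rw [← ker_adjoinRootToQuotient ha, RingHom.mem_ker, adjoinRootToQuotient_of,
    Ideal.Quotient.eq_zero_iff_dvd]

theorem isPrime_span_root_of (hprime : Prime a) :
    (Ideal.span {AdjoinRoot.root f, AdjoinRoot.of f a}).IsPrime := by
  have := (Ideal.span_singleton_prime hprime.ne_zero).mpr hprime
  rw [← ker_adjoinRootToQuotient ha]
  exact RingHom.ker_isPrime _

end AdjoinRootQuotient

theorem isUnit_of_of_dvd_root_pow {A : Type*} [CommRing A] {f : Polynomial A} (hf : f.Monic)
    {a : A} {m : ℕ} (hm : m < f.natDegree) (hdvd : AdjoinRoot.of f a ∣ AdjoinRoot.root f ^ m) :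
    IsUnit a := by
  nontriviality A
  obtain ⟨y, hy⟩ := hdvd
  rw [← AdjoinRoot.mk_X, ← map_pow, ← AdjoinRoot.algebraMap_eq, ← Algebra.smul_def] at hy
  have hmod := congrArg (AdjoinRoot.modByMonicHom hf) hy
  have hdeg : (Polynomial.X ^ m : Polynomial A).degree < f.degree :=
    Polynomial.degree_lt_degree (by rwa [Polynomial.natDegree_X_pow])
  rw [AdjoinRoot.modByMonicHom_mk, (Polynomial.modByMonic_eq_self_iff hf).mpr hdeg,
    map_smul] at hmod
  refine isUnit_of_dvd_one ⟨(AdjoinRoot.modByMonicHom hf y).coeff m, ?_⟩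
  rw [← smul_eq_mul, ← Polynomial.coeff_smul, ← hmod, Polynomial.coeff_X_pow_self]

theorem dvd_pow_sub_one_of_sq_dvd_pow {R : Type*} [CommRing R] [IsDomain R]
    [IsIntegrallyClosed R] {a b : R} {n : ℕ} (hn : 2 ≤ n) (h : a ^ 2 ∣ b ^ n) :
    a ∣ b ^ (n - 1) := by
  refine (IsIntegrallyClosed.pow_dvd_pow_iff (by lia : n ≠ 0)).mp ?_
  calc a ^ n ∣ (a ^ 2) ^ (n - 1) := by
        rw [← pow_mul]
        exact pow_dvd_pow a (by lia)
    _ ∣ (b ^ n) ^ (n - 1) := pow_dvd_pow_of_dvd h _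
    _ = (b ^ (n - 1)) ^ n := pow_right_comm b n (n - 1)

theorem prime_X_pow_sub_C {A : Type*} [CommRing A] [IsDomain A] [UniqueFactorizationMonoid A]
    {a π : A} (hπ : Prime π) (hdvd : π ∣ a) (hsq : ¬ π ^ 2 ∣ a) {n : ℕ} (hn : n ≠ 0) :
    Prime (Polynomial.X ^ n - Polynomial.C a) := by
  have hmonic : (Polynomial.X ^ n - Polynomial.C a).Monic := Polynomial.monic_X_pow_sub_C a hn
  have hdeg := Polynomial.degree_X_pow_sub_C (Nat.pos_of_ne_zero hn) a
  refine (Polynomial.irreducible_of_eisenstein_criterion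
    ((Ideal.span_singleton_prime hπ.ne_zero).mpr hπ) ?_ (fun m hm => ?_) ?_ ?_
    hmonic.isPrimitive).prime
  · rw [hmonic.leadingCoeff, Ideal.mem_span_singleton]
    exact hπ.not_dvd_one
  · rw [hdeg, Nat.cast_lt] at hm
    rw [Polynomial.coeff_sub, Polynomial.coeff_X_pow, if_neg hm.ne, zero_sub, neg_mem_iff,
      Polynomial.coeff_C, Ideal.mem_span_singleton]
    split_ifs
    exacts [hdvd, dvd_zero π]
  · rw [hdeg]
    exact_mod_cast Nat.pos_of_ne_zero hn
  · rwa [Polynomial.coeff_sub, Polynomial.coeff_X_pow, if_neg hn.symm, zero_sub, neg_mem_iff,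
      Polynomial.coeff_C_zero, Ideal.span_singleton_pow, Ideal.mem_span_singleton]

section RenameSucc

open MvPolynomial

variable {A : Type*} [CommRing A] {d : ℕ}

theorem finSuccEquiv_rename_succ (h : MvPolynomial (Fin d) A) :
    finSuccEquiv A d (rename Fin.succ h) = Polynomial.C h := by
  induction h using MvPolynomial.induction_on with
  | C c => rw [rename_C, ← MvPolynomial.algebraMap_eq, AlgEquiv.commutes]; rfl
  | add p q hp hq => simp only [map_add, hp, hq]
  | mul_X p i hp => simp only [map_mul, rename_X, hp, finSuccEquiv_X_succ]

theorem rename_succ_dvd_rename_succ_iff {h h' : MvPolynomial (Fin d) A} :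
    rename Fin.succ h ∣ rename Fin.succ h' ↔ h ∣ h' := by
  refine ⟨fun H => ?_, map_dvd _⟩
  have H' := map_dvd (finSuccEquiv A d) H
  rw [finSuccEquiv_rename_succ, finSuccEquiv_rename_succ, Polynomial.C_dvd_iff_dvd_coeff] at H'
  exact Polynomial.coeff_C_zero (a := h') ▸ H' 0

theorem isUnit_of_rename_succ_dvd_X_zero {h : MvPolynomial (Fin d) A}
    (H : rename Fin.succ h ∣ X 0) : IsUnit h := by
  have H' := map_dvd (finSuccEquiv A d) H
  rw [finSuccEquiv_rename_succ, finSuccEquiv_X_zero, Polynomial.C_dvd_iff_dvd_coeff] at H'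
  exact isUnit_of_dvd_one (Polynomial.coeff_X_one (R := MvPolynomial (Fin d) A) ▸ H' 1)

theorem not_X_zero_dvd_rename_succ {h : MvPolynomial (Fin d) A} (hh : h ≠ 0) :
    ¬ X 0 ∣ rename Fin.succ h := fun H => by
  have H' := map_dvd (finSuccEquiv A d) H
  rw [finSuccEquiv_rename_succ, finSuccEquiv_X_zero, Polynomial.X_dvd_iff,
    Polynomial.coeff_C_zero] at H'
  exact hh H'

theorem prime_rename_succ {h : MvPolynomial (Fin d) A} (hh : Prime h) :
    Prime (rename Fin.succ h) := by
  rw [← MulEquiv.prime_iff (finSuccEquiv A d).toMulEquiv]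
  exact (finSuccEquiv_rename_succ h).symm ▸ Polynomial.prime_C_iff.mpr hh

end RenameSucc

namespace CyclicHypersurface

open MvPolynomial

variable {k : Type*} [Field k] {d n : ℕ} {g h : MvPolynomial (Fin d) k}

/-- The image of the variable `x₀`. -/
noncomputable def x₀ (n : ℕ) (g : MvPolynomial (Fin d) k) : CyclicHypersurface n g :=
  AdjoinRoot.of _ (X 0)

/-- The ring homomorphism from `k[x_1,…,x_d][z]` to `k[z,x_0,…,x_d]/(z^n - x_0 g)`. -/
noncomputable def incl (n : ℕ) (g : MvPolynomial (Fin d) k) :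
    Polynomial (MvPolynomial (Fin d) k) →+* CyclicHypersurface n g :=
  Polynomial.eval₂RingHom ((AdjoinRoot.of _).comp (rename Fin.succ).toRingHom) (z n g)

@[simp]
theorem incl_C (h : MvPolynomial (Fin d) k) : incl n g (Polynomial.C h) = ofPoly n g h :=
  Polynomial.eval₂_C _ _

@[simp]
theorem incl_X : incl n g Polynomial.X = z n g :=
  Polynomial.eval₂_X _ _

theorem ofPoly_mul (a b : MvPolynomial (Fin d) k) :
    ofPoly n g (a * b) = ofPoly n g a * ofPoly n g b := by
  simp only [← incl_C, map_mul]

theorem ofPoly_dvd_ofPoly {a b : MvPolynomial (Fin d) k} (hab : a ∣ b) :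
    ofPoly n g a ∣ ofPoly n g b := by
  simpa only [incl_C] using map_dvd (incl n g) (map_dvd Polynomial.C hab)

theorem z_pow : z n g ^ n = x₀ n g * ofPoly n g g := by
  refine sub_eq_zero.mp (Eq.trans ?_ (AdjoinRoot.mk_self
    (f := Polynomial.X ^ n - Polynomial.C (X 0 * rename Fin.succ g))))
  simp only [map_sub, map_pow, AdjoinRoot.mk_X, AdjoinRoot.mk_C, map_mul]
  rfl

theorem isDomain (hn : n ≠ 0) (hg : g ≠ 0) : IsDomain (CyclicHypersurface n g) := by
  have hX : Prime (X 0 : MvPolynomial (Fin (d + 1)) k) := X_prime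
  refine AdjoinRoot.isDomain_of_prime (prime_X_pow_sub_C hX (dvd_mul_right _ _) ?_ hn)
  rw [sq, mul_dvd_mul_iff_left hX.ne_zero]
  exact not_X_zero_dvd_rename_succ hg

theorem exists_comp_incl_eq_algebraMap (hg : g ≠ 0) :
    ∃ θ : CyclicHypersurface n g →+* FractionRing (Polynomial (MvPolynomial (Fin d) k)),
      θ.comp (incl n g) = algebraMap _ _ := by
  let K := FractionRing (Polynomial (MvPolynomial (Fin d) k))
  let a : Polynomial (MvPolynomial (Fin d) k) →+* K := algebraMap _ _
  have ha : a (Polynomial.C g) ≠ 0 :=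
    (map_ne_zero_iff a (IsFractionRing.injective _ _)).mpr (Polynomial.C_ne_zero.mpr hg)
  -- `x₀ = z ^ n / g`
  let τ : MvPolynomial (Fin (d + 1)) k →+* K :=
    eval₂Hom (a.comp (Polynomial.C.comp C))
      (Fin.cons (a Polynomial.X ^ n / a (Polynomial.C g)) fun i => a (Polynomial.C (X i)))
  have hτX : τ (X 0) = a Polynomial.X ^ n / a (Polynomial.C g) := by simp [τ]
  have hτ : τ.comp (rename Fin.succ).toRingHom = a.comp Polynomial.C :=
    MvPolynomial.ringHom_ext (fun c => by simp [τ]) (fun i => by simp [τ])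
  have hτrename : ∀ h, τ (rename Fin.succ h) = a (Polynomial.C h) := RingHom.congr_fun hτ
  have hroot : (Polynomial.X ^ n - Polynomial.C (X 0 * rename Fin.succ g)).eval₂ τ
      (a Polynomial.X) = 0 := by
    rw [Polynomial.eval₂_sub, Polynomial.eval₂_X_pow, Polynomial.eval₂_C, map_mul, hτX,
      hτrename, div_mul_cancel₀ _ ha, sub_self]
  refine ⟨AdjoinRoot.lift τ _ hroot, Polynomial.ringHom_ext (fun h => ?_) ?_⟩
  · rw [RingHom.comp_apply, incl_C, ofPoly, AdjoinRoot.lift_of, hτrename]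
  · rw [RingHom.comp_apply, incl_X, z, AdjoinRoot.lift_root]

theorem incl_injective (hg : g ≠ 0) : Function.Injective (incl n g) := by
  obtain ⟨θ, hθ⟩ := exists_comp_incl_eq_algebraMap (n := n) hg
  refine Function.Injective.of_comp (f := θ) ?_
  rw [← RingHom.coe_comp, hθ]
  exact IsFractionRing.injective _ _

theorem closure_insert_x₀_range_incl_eq_top :
    Subring.closure (insert (x₀ n g) (Set.range (incl n g))) = ⊤ := by
  set S := Subring.closure (insert (x₀ n g) (Set.range (incl n g)))
  have hx₀ : x₀ n g ∈ S := Subring.subset_closure (Set.mem_insert _ _)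
  have hincl : ∀ b, incl n g b ∈ S := fun b =>
    Subring.subset_closure (Set.mem_insert_of_mem _ ⟨b, rfl⟩)
  have hz : z n g ∈ S := incl_X (n := n) (g := g) ▸ hincl Polynomial.X
  have hofPoly : ∀ h, ofPoly n g h ∈ S := fun h => incl_C h ▸ hincl (Polynomial.C h)
  have hof : ∀ F, AdjoinRoot.of _ F ∈ S := fun F => by
    induction F using MvPolynomial.induction_on with
    | C c => simpa only [ofPoly, rename_C] using hofPoly (C c)
    | add F G hF hG => rw [map_add]; exact add_mem hF hG
    | mul_X F i hF =>
      rw [map_mul (AdjoinRoot.of _)]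
      refine mul_mem hF (i.cases hx₀ (fun i => ?_))
      simpa only [ofPoly, rename_X] using hofPoly (X i)
  refine (Subring.eq_top_iff' S).mpr fun a => ?_
  obtain ⟨p, rfl⟩ := AdjoinRoot.mk_surjective a
  induction p using Polynomial.induction_on with
  | C F => exact hof F
  | add p q hp hq => rw [map_add]; exact add_mem hp hq
  | monomial m F hF =>
    rw [pow_succ, ← mul_assoc, map_mul (AdjoinRoot.mk _)]
    exact mul_mem hF hz

theorem isIsoAway_incl (hg : g ≠ 0) : IsIsoAway (incl n g) (Polynomial.C g) := by
  refine .of_closure_eq_top (incl_injective hg) closure_insert_x₀_range_incl_eq_top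
    ⟨1, Polynomial.X ^ n, ?_⟩
  rw [pow_one, incl_C, map_pow, incl_X, z_pow, mul_comm]

theorem ofPoly_ne_zero (hg : g ≠ 0) (hh : h ≠ 0) : ofPoly n g h ≠ 0 :=
  incl_C (n := n) (g := g) h ▸ (isIsoAway_incl hg).map_ne_zero (Polynomial.C_ne_zero.mpr hh)

theorem z_ne_zero (hg : g ≠ 0) : z n g ≠ 0 :=
  incl_X (n := n) (g := g) ▸ (isIsoAway_incl hg).map_ne_zero Polynomial.X_ne_zero

theorem squarefree_of_isIntegrallyClosed (hn : 2 ≤ n) (hg : g ≠ 0)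
    [IsIntegrallyClosed (CyclicHypersurface n g)] : Squarefree g := by
  intro h hhg
  have := isDomain (n := n) (by lia) hg
  have hz : ofPoly n g h ^ 2 ∣ z n g ^ n := by
    rw [z_pow, sq, ← ofPoly_mul]
    exact (ofPoly_dvd_ofPoly hhg).mul_left _
  have hmonic := Polynomial.monic_X_pow_sub_C (X 0 * rename Fin.succ g) (by lia : n ≠ 0)
  have hunit : IsUnit (rename Fin.succ h : MvPolynomial (Fin (d + 1)) k) := by
    refine isUnit_of_of_dvd_root_pow hmonic (m := n - 1) ?_
      (dvd_pow_sub_one_of_sq_dvd_pow hn hz)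
    rw [Polynomial.natDegree_X_pow_sub_C]
    lia
  exact isUnit_of_rename_succ_dvd_X_zero hunit.dvd

section PrimeOver

theorem rename_succ_dvd_coeff_zero (hn : n ≠ 0) (hhg : h ∣ g) :
    rename Fin.succ h ∣ (Polynomial.X ^ n -
      Polynomial.C (X 0 * rename Fin.succ g) : Polynomial (MvPolynomial (Fin (d + 1)) k)).coeff
        0 := by
  rw [Polynomial.coeff_sub, Polynomial.coeff_X_pow, if_neg hn.symm, zero_sub,
    Polynomial.coeff_C_zero, dvd_neg]
  exact (map_dvd _ hhg).mul_left _

theorem x₀_mem_span_iff (hn : n ≠ 0) (hhg : h ∣ g) :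
    x₀ n g ∈ Ideal.span {z n g, ofPoly n g h} ↔ IsUnit h :=
  (of_mem_span_root_of_iff (rename_succ_dvd_coeff_zero hn hhg)).trans
    ⟨isUnit_of_rename_succ_dvd_X_zero, fun hu => (hu.map (rename Fin.succ)).dvd⟩

theorem ofPoly_mem_span_iff (hn : n ≠ 0) (hhg : h ∣ g) {h' : MvPolynomial (Fin d) k} :
    ofPoly n g h' ∈ Ideal.span {z n g, ofPoly n g h} ↔ h ∣ h' :=
  (of_mem_span_root_of_iff (rename_succ_dvd_coeff_zero hn hhg)).trans
    rename_succ_dvd_rename_succ_iff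

theorem isPrime_span (hn : n ≠ 0) (hh : Prime h) (hhg : h ∣ g) :
    (Ideal.span {z n g, ofPoly n g h}).IsPrime :=
  isPrime_span_root_of (rename_succ_dvd_coeff_zero hn hhg) (prime_rename_succ hh)

theorem span_le_of_isPrime (hhg : h ∣ g) {q : Ideal (CyclicHypersurface n g)} (hq : q.IsPrime)
    (hmem : ofPoly n g h ∈ q) : Ideal.span {z n g, ofPoly n g h} ≤ q := by
  have hg : ofPoly n g g ∈ q := q.mem_of_dvd (ofPoly_dvd_ofPoly hhg) hmem
  rw [Ideal.span_le, Set.insert_subset_iff, Set.singleton_subset_iff]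
  exact ⟨hq.mem_of_pow_mem n (z_pow (n := n) (g := g) ▸ Ideal.mul_mem_left _ _ hg), hmem⟩

theorem height_span (hn : n ≠ 0) (hg : g ≠ 0) (hh : Prime h) (hhg : h ∣ g) :
    (Ideal.span {z n g, ofPoly n g h}).height = 1 := by
  have := isDomain hn hg
  refine height_eq_one_of_mem_minimalPrimes_span_singleton (ofPoly_ne_zero hg hh.ne_zero)
    ⟨⟨isPrime_span hn hh hhg, ?_⟩, fun q ⟨hq, hle⟩ _ => ?_⟩
  · exact Ideal.span_mono (Set.subset_insert _ _)
  · exact span_le_of_isPrime hhg hq ((Ideal.span_singleton_le_iff_mem _).mp hle)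

/-- The height one prime `(z, h)` attached to a prime factor `h` of `g`. -/
noncomputable def primeOver (hn : n ≠ 0) (hg : g ≠ 0) (hh : Prime h) (hhg : h ∣ g) :
    HeightOnePrime (CyclicHypersurface n g) :=
  ⟨Ideal.span {z n g, ofPoly n g h}, isPrime_span hn hh hhg, height_span hn hg hh hhg⟩

variable (hn : n ≠ 0) (hg : g ≠ 0) (hh : Prime h) (hhg : h ∣ g)

theorem eq_primeOver {q : HeightOnePrime (CyclicHypersurface n g)}
    (hq : ofPoly n g h ∈ q.asIdeal) : q = primeOver hn hg hh hhg := by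
  have := isDomain hn hg
  exact HeightOnePrime.ext (q.eq_of_le (primeOver hn hg hh hhg).isPrime
    (primeOver hn hg hh hhg).asIdeal_ne_bot (span_le_of_isPrime hhg q.isPrime hq)).symm

theorem natOrd_primeOver (hsq : n ≠ 1 → Squarefree g) :
    (primeOver hn hg hh hhg).natOrd (ofPoly n g h) = n := by
  have := isDomain hn hg
  obtain ⟨w, hw⟩ := id hhg
  have hz : z n g ^ n = ofPoly n g h * (x₀ n g * ofPoly n g w) := by
    rw [z_pow, mul_left_comm, ← ofPoly_mul, ← hw]
  rcases eq_or_ne n 1 with rfl | hn1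
  · refine HeightOnePrime.natOrd_eq_one_of_asIdeal_eq_span (Submodule.span_insert_eq_span ?_)
    exact Ideal.mem_span_singleton.mpr ⟨_, pow_one (z 1 g) ▸ hz⟩
  · refine HeightOnePrime.natOrd_eq_of_pow_eq_mul hn rfl (z_ne_zero hg) (fun hmem => ?_) hz
    rcases (isPrime_span hn hh hhg).mem_or_mem hmem with hx₀ | hw'
    · exact hh.not_isUnit ((x₀_mem_span_iff hn hhg).mp hx₀)
    · have hhw : h ∣ w := (ofPoly_mem_span_iff hn hhg).mp hw'
      exact hh.not_isUnit (hsq hn1 h (hw ▸ mul_dvd_mul_left h hhw))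

theorem div_ofPoly (hsq : n ≠ 1 → Squarefree g) :
    haveI := isDomain hn hg
    WeilDivisor.div (ofPoly n g h) = Finsupp.single (primeOver hn hg hh hhg) (n : ℤ) := by
  have := isDomain hn hg
  ext q
  rw [WeilDivisor.div_apply]
  rcases eq_or_ne q (primeOver hn hg hh hhg) with rfl | hq
  · rw [natOrd_primeOver hn hg hh hhg hsq, Finsupp.single_eq_same]
  · rw [(q.natOrd_eq_zero_iff (ofPoly_ne_zero hg hh.ne_zero)).mpr fun hmem =>
      hq (eq_primeOver hn hg hh hhg hmem), Finsupp.single_eq_of_ne hq, Nat.cast_zero]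

theorem dvd_of_primeOver_eq {h' : MvPolynomial (Fin d) k} (hh' : Prime h') (hhg' : h' ∣ g)
    (heq : primeOver hn hg hh hhg = primeOver hn hg hh' hhg') : h ∣ h' := by
  have hspan : Ideal.span {z n g, ofPoly n g h} = Ideal.span {z n g, ofPoly n g h'} :=
    congrArg HeightOnePrime.asIdeal heq
  rw [← ofPoly_mem_span_iff hn hhg, hspan]
  exact Ideal.subset_span (Or.inr rfl)

end PrimeOver

section Factorization

variable {ι : Type*} [Fintype ι] {h : ι → MvPolynomial (Fin d) k}

theorem isIsoAway_incl_prod (hg : g ≠ 0) (hprod : g = ∏ i, h i) :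
    IsIsoAway (incl n g) (∏ i, Polynomial.C (h i)) := by
  rw [← map_prod, ← hprod]
  exact isIsoAway_incl hg

variable (hn : n ≠ 0) (hg : g ≠ 0) (hh : ∀ i, Prime (h i)) (hprod : g = ∏ i, h i)

/-- The height one primes `(z, h i)` attached to a factorization `g = ∏ i, h i` into primes. -/
noncomputable def factorPrime (i : ι) : HeightOnePrime (CyclicHypersurface n g) :=
  primeOver hn hg (hh i) (hprod ▸ Finset.dvd_prod_of_mem h (Finset.mem_univ i))

theorem factorPrime_injective (hsq : Squarefree g) :
    Function.Injective (factorPrime hn hg hh hprod) := fun i l hil => by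
  classical
  by_contra hne
  refine (hh i).not_isUnit (hsq (h i) ?_)
  rw [hprod, ← Finset.mul_prod_erase _ _ (Finset.mem_univ i)]
  exact mul_dvd_mul_left _ ((dvd_of_primeOver_eq hn hg (hh i) _ (hh l) _ hil).trans
    (Finset.dvd_prod_of_mem h (Finset.mem_erase.mpr ⟨Ne.symm hne, Finset.mem_univ l⟩)))

variable (hsq : n ≠ 1 → Squarefree g)

include hsq

theorem div_incl_C (i : ι) :
    haveI := isDomain hn hg
    WeilDivisor.div (incl n g (Polynomial.C (h i))) =
      Finsupp.single (factorPrime hn hg hh hprod i) (n : ℤ) :=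
  incl_C (n := n) (g := g) (h i) ▸ div_ofPoly hn hg (hh i) _ hsq

theorem closure_range_factorPrime :
    AddSubgroup.closure (Set.range fun i => (factorPrime hn hg hh hprod i).divisorClass) = ⊤ := by
  have := isDomain hn hg
  exact (isIsoAway_incl_prod hg hprod).closure_range_divisorClass_eq_top
    (div_incl_C hn hg hh hprod hsq) fun i => Polynomial.C_ne_zero.mpr (hh i).ne_zero

theorem sum_zsmul_factorPrime_eq_zero_iff {m : ι → ℤ} :
    ∑ i, m i • (factorPrime hn hg hh hprod i).divisorClass = 0 ↔ ∀ i, (n : ℤ) ∣ m i := by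
  have := isDomain hn hg
  have hj := isIsoAway_incl_prod (n := n) hg hprod
  have hdiv := div_incl_C hn hg hh hprod hsq
  have hprime : ∀ i, Prime (Polynomial.C (h i)) := fun i => Polynomial.prime_C_iff.mpr (hh i)
  rcases eq_or_ne n 1 with rfl | hn1
  · -- For `n = 1` the primes `(z, h i) = (h i)` need not be distinct, but they are principal.
    have hzero : ∀ i, (factorPrime hn hg hh hprod i).divisorClass = 0 := fun i =>
      (one_nsmul _).symm.trans (WeilDivisor.nsmul_divisorClass_eq_zero
        (hj.map_ne_zero (hprime i).ne_zero) (hdiv i))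
    simp only [hzero, zsmul_zero, Finset.sum_const_zero, Nat.cast_one, one_dvd, implies_true]
  · exact hj.sum_zsmul_divisorClass_eq_zero_iff hdiv hprime (fun _ => hn)
      (factorPrime_injective hn hg hh hprod (hsq hn1))

end Factorization

end CyclicHypersurface

open CyclicHypersurface

theorem corollary3p4_general {k ι : Type*} [Field k] [Fintype ι] {d n : ℕ} (hn : n ≠ 0)
    {g : MvPolynomial (Fin d) k} (hsq : n ≠ 1 → Squarefree g) {h : ι → MvPolynomial (Fin d) k}
    (hirr : ∀ i, Irreducible (h i)) (hprod : g = ∏ i, h i) :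
    Nonempty (DivisorClassGroup (CyclicHypersurface n g) ≃+ (ι → ZMod n)) ∧
    ∃ p : ι → HeightOnePrime (CyclicHypersurface n g),
      (∀ i, (p i).asIdeal = Ideal.span {z n g, ofPoly n g (h i)}) ∧
      AddSubgroup.closure (Set.range fun i => (p i).divisorClass) = ⊤ ∧
      (2 ≤ n → ∀ s : Set ι,
        AddSubgroup.closure ((fun i => (p i).divisorClass) '' s) = ⊤ → s = Set.univ) := by
  classical
  have hprime : ∀ i, Prime (h i) := fun i => (hirr i).prime
  have hg : g ≠ 0 := hprod ▸ Finset.prod_ne_zero_iff.mpr fun i _ => (hprime i).ne_zero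
  have hgen := closure_range_factorPrime hn hg hprime hprod hsq
  obtain ⟨e, he⟩ := exists_addEquiv_pi_zmod (n := fun _ => n) hgen fun _ =>
    sum_zsmul_factorPrime_eq_zero_iff hn hg hprime hprod hsq
  exact ⟨⟨e⟩, factorPrime hn hg hprime hprod, fun _ => rfl, hgen,
    fun hn2 _ hs => eq_univ_of_closure_image_eq_top e he (fun _ => by lia) hs⟩

theorem corollary3p4 {k : Type*} [Field k] (d n r : ℕ) (hn : 1 ≤ n)
    (g : MvPolynomial (Fin d) k) (hg : IsWeightedHomogeneousPoly g)
    (h : Fin r → MvPolynomial (Fin d) k) (hirr : ∀ i, Irreducible (h i)) (hprod : g = ∏ i, h i)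
    (hnormal : IsIntegrallyClosed (CyclicHypersurface n g)) :
    Nonempty (DivisorClassGroup (CyclicHypersurface n g) ≃+ (Fin r → ZMod n)) ∧
    ∃ p : Fin r → HeightOnePrime (CyclicHypersurface n g),
      (∀ i, (p i).asIdeal =
        Ideal.span {CyclicHypersurface.z n g, CyclicHypersurface.ofPoly n g (h i)}) ∧
      AddSubgroup.closure (Set.range fun i => (p i).divisorClass) = ⊤ ∧
      (2 ≤ n → ∀ s : Set (Fin r),
        AddSubgroup.closure ((fun i => (p i).divisorClass) '' s) = ⊤ → s = Set.univ) :=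
  corollary3p4_general (by lia) (fun hn1 => squarefree_of_isIntegrallyClosed (n := n) (by lia)
    (hprod ▸ Finset.prod_ne_zero_iff.mpr fun i _ => (hirr i).ne_zero)) hirr hprod
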